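/- Let $\mathcal F$ be the complex Fock space of Ramond type: it is generated by a vector $|0\rangle$ under operators $\phi_n$ ($n\in\mathbb Z$) with $\phi_m\phi_n+\phi_n\phi_m=\delta_{m,-n}$ and $\phi_n|0\rangle=0$ for $n>0$, and it has as a basis the vectors $\phi_\lambda=\phi_{-\lambda_1}\cdots\phi_{-\lambda_\ell}|0\rangle$ and $\phi_\lambda\phi_0=\phi_{-\lambda_1}\cdots\phi_{-\lambda_\ell}\phi_0|0\rangle$, where $\lambda=(\lambda_1>\dots>\lambda_\ell>0)$ runs over all strict partitions (including the empty one) and $\ell(\lambda)=\ell$. Let $L_0$ be the grading operator which multiplies both $\phi_\lambda$ and $\phi_\lambda\phi_0$ by $|\lambda|=\lambda_1+\dots+\lambda_\ell$. Let $\mathcal F_0\subset\mathcal F$ be the span of the $\phi_\lambda$ with $\ell(\lambda)$ even and the $\phi_\lambda\phi_0$ with $\ell(\lambda)$ odd. For $k>0$ the normally ordered product is $:\!\phi_{-k}\phi_k\!:\;=\phi_{-k}\phi_k$. Put $$:\!\mathcal B_0(t)\!:\;=\sum_{k\ge 1}(t^k-t^{-k}):\!\phi_{-k}\phi_k\!:,\qquad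 \mathcal B_0(t)=\;:\!\mathcal B_0(t)\!:+\frac{t+1}{2(t-1)}\,I,$$ and define the one-point functions $$:\!R\!:(t)=\mathrm{Tr}|_{\mathcal F_0}\,q^{L_0}:\!\mathcal B_0(t)\!:,\qquad R(t)=\mathrm{Tr}|_{\mathcal F_0}\,q^{L_0}\mathcal B_0(t),$$ the traces being the sums of the diagonal entries in the above basis of $\mathcal F_0$. Let $(a;q)_\infty=\prod_{i\ge0}(1-aq^i)$, $\theta_{j,1}(q,t)=\sum_{n\in j/2+\mathbb Z}q^{n^2}t^n$ for $j=0,1$, and $\mathbb B(q,t)=\theta_{1,1}(q,-t)/\theta_{0,1}(q,-t)$. **Theorem.** Let $q,t\in\mathbb C$ with $|q|<1$ and $|q|<|t|<|q|^{-1}$ (with $|q|^{-1}=\infty$ if $q=0$). 1. The trace defining $:\!R\!:(t)$ and the two series below converge absolutely, and $$:\!R\!:(t)=(-q;q)_\infty\sum_{n=1}^\infty\frac{q^n(t^n-t^{-n})}{1+q^n}=(-q;q)_\infty\sum_{r=0}^\infty\left(\frac{(-1)^rq^{r+1}t}{1-q^{r+1}t}-\frac{(-1)^rq^{r+1}t^{-1}}{1-q^{r+1}t^{-1}}\right).$$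 2. If $t\ne1$, the trace defining $R(t)$ converges absolutely. If moreover $q\neq 0$, then for every choice of a logarithm of $q$ and of a holomorphic branch of $z\mapsto\log(-z)$ near $t$ (used to define $q^{n^2}$ and $(-z)^n$ for half-integers $n$), $\mathbb B(q,\cdot)$ has a holomorphic logarithm near $t$, and for every such holomorphic branch of $\ln\mathbb B(q,\cdot)$, $$R(t)=(-q;q)_\infty\cdot t\,\frac{d}{dt}\ln\mathbb B(q,t).$$ -/

import Mathlib

namespace RamondFock

open Filter Topology

/-! ## The Fock space of Ramond type

The basis vector indexed by a finite set `S = {s₁ > s₂ > ⋯ > sₘ}` of natural numbers stands for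
`φ_{-s₁} φ_{-s₂} ⋯ φ_{-sₘ} |0⟩`.  With `λ = S \ {0}` (a strict partition) it is `φ_λ` if `0 ∉ S`
and `φ_λ φ_0` if `0 ∈ S`; see `prod_phi_vac` for the verification. -/

/-- The Fock space `𝓕`. -/
abbrev Fock : Type := Finset ℕ →₀ ℂ

/-- The basis vectors of `𝓕`. -/
noncomputable def e (S : Finset ℕ) : Fock := Finsupp.single S 1

/-- The highest weight vector `|0⟩`. -/
noncomputable def vac : Fock := e ∅

/-- The sign `(-1)^{#{s ∈ S : s > n}}` picked up by moving `φ_{±n}` past the `φ_{-s}`,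
`s ∈ S`, `s > n`. -/
def sgn (S : Finset ℕ) (n : ℕ) : ℂ := (-1) ^ (S.filter (fun s => n < s)).card

/-- Inserting the mode `n` (zero if it is already occupied). -/
noncomputable def create (n : ℕ) : Module.End ℂ Fock :=
  Finsupp.linearCombination ℂ fun S => if n ∈ S then 0 else sgn S n • e (insert n S)

/-- Removing the mode `n` (zero if it is not occupied). -/
noncomputable def annih (n : ℕ) : Module.End ℂ Fock :=
  Finsupp.linearCombination ℂ fun S => if n ∈ S then sgn S n • e (S.erase n) else 0

/-- The operators `φ_m`, `m ∈ ℤ`, on the Fock space. -/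
noncomputable def phi (m : ℤ) : Module.End ℂ Fock :=
  if m < 0 then create m.natAbs
  else if 0 < m then annih m.natAbs
  else create 0 + (1 / 2 : ℂ) • annih 0

theorem phi_neg {n : ℕ} (hn : 0 < n) : phi (-(n : ℤ)) = create n := by
  have h : -(n : ℤ) < 0 := by omega
  simp only [phi, if_pos h]
  simp

theorem phi_pos {n : ℕ} (hn : 0 < n) : phi (n : ℤ) = annih n := by
  have h : ¬ (n : ℤ) < 0 := by omega
  have h' : 0 < (n : ℤ) := by omega
  simp only [phi, if_neg h, if_pos h']
  simp

theorem phi_zero : phi 0 = create 0 + (1 / 2 : ℂ) • annih 0 := by simp [phi]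

theorem create_e (n : ℕ) (S : Finset ℕ) :
    create n (e S) = if n ∈ S then 0 else sgn S n • e (insert n S) := by
  simp [create, e]

theorem annih_e (n : ℕ) (S : Finset ℕ) :
    annih n (e S) = if n ∈ S then sgn S n • e (S.erase n) else 0 := by
  simp [annih, e]

theorem end_ext {A B : Module.End ℂ Fock} (h : ∀ S, A (e S) = B (e S)) : A = B :=
  Finsupp.lhom_ext' fun S => LinearMap.ext_ring (h S)

theorem sgn_insert {S : Finset ℕ} {m n : ℕ} (hm : m ∉ S) :
    sgn (insert m S) n = if n < m then - sgn S n else sgn S n := by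
  unfold sgn
  rw [Finset.filter_insert]
  split_ifs with h
  · rw [Finset.card_insert_of_notMem (by simp [hm]), pow_succ]; ring
  · rfl

theorem sgn_erase {S : Finset ℕ} {m n : ℕ} (hm : m ∈ S) :
    sgn (S.erase m) n = if n < m then - sgn S n else sgn S n := by
  have h := sgn_insert (n := n) (Finset.notMem_erase m S)
  rw [Finset.insert_erase hm] at h
  rw [h]; split_ifs <;> simp

theorem sgn_mul_self (S : Finset ℕ) (n : ℕ) : sgn S n * sgn S n = 1 := by
  unfold sgn; rw [← mul_pow]; simp

theorem create_anticomm (m n : ℕ) : create m * create n + create n * create m = 0 := by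
  refine end_ext fun S => ?_
  rcases eq_or_ne m n with rfl | hmn
  · by_cases hm : m ∈ S <;> simp [create_e, hm]
  rcases hmn.lt_or_gt with h | h
  all_goals
    by_cases hm : m ∈ S <;> by_cases hn : n ∈ S <;>
    simp [create_e, hm, hn, sgn_insert, Finset.mem_insert, smul_smul, h.ne, h.ne', h.not_gt, h,
      Finset.insert_comm m n, mul_comm (sgn S m)]

theorem annih_anticomm (m n : ℕ) : annih m * annih n + annih n * annih m = 0 := by
  refine end_ext fun S => ?_
  rcases eq_or_ne m n with rfl | hmn
  · by_cases hm : m ∈ S <;> simp [annih_e, hm]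
  rcases hmn.lt_or_gt with h | h
  all_goals
    by_cases hm : m ∈ S <;> by_cases hn : n ∈ S <;>
    simp [annih_e, hm, hn, sgn_erase, smul_smul, h.ne, h.ne', h.not_gt, h,
      Finset.erase_right_comm (a := m) (b := n), mul_comm (sgn S m)]

theorem create_annih_anticomm (m n : ℕ) :
    create m * annih n + annih n * create m = if m = n then 1 else 0 := by
  refine end_ext fun S => ?_
  rcases lt_trichotomy m n with h | rfl | h
  · by_cases hm : m ∈ S <;> by_cases hn : n ∈ S <;>
    simp [annih_e, create_e, hm, hn, sgn_erase, sgn_insert, smul_smul, h.ne, h.ne', h.not_gt, h,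
      Finset.erase_insert_of_ne h.ne, mul_comm (sgn S m)]
  · by_cases hm : m ∈ S <;>
    simp [annih_e, create_e, hm, sgn_erase, sgn_insert, smul_smul, sgn_mul_self]
  · by_cases hm : m ∈ S <;> by_cases hn : n ∈ S <;>
    simp [annih_e, create_e, hm, hn, sgn_erase, sgn_insert, smul_smul, h.ne, h.ne', h.not_gt, h,
      Finset.erase_insert_of_ne h.ne', mul_comm (sgn S m)]

/-- The canonical anticommutation relations `[φ_m, φ_n]_+ = δ_{m,-n}`. -/
theorem phi_anticomm (m n : ℤ) :
    phi m * phi n + phi n * phi m = if m = -n then 1 else 0 := by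
  have key : ∀ m n : ℤ, m ≤ n → phi m * phi n + phi n * phi m = if m = -n then 1 else 0 := by
    intro m n hmn
    have cc := create_anticomm m.natAbs n.natAbs
    have aa := annih_anticomm m.natAbs n.natAbs
    have ca := create_annih_anticomm m.natAbs n.natAbs
    have ca' := create_annih_anticomm n.natAbs m.natAbs
    rcases lt_trichotomy m 0 with hm | rfl | hm <;> rcases lt_trichotomy n 0 with hn | rfl | hn
    · rw [if_neg (by omega)]
      simpa [phi, hm, hn] using cc
    · rw [if_neg (by omega)]
      rw [if_neg (by omega)] at ca
      simp only [Int.natAbs_zero] at cc ca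
      simp only [phi, if_pos hm, lt_irrefl, if_false, mul_add, add_mul, mul_smul_comm,
        smul_mul_assoc]
      rw [add_add_add_comm, cc, ← smul_add, ca, smul_zero, add_zero]
    · simp only [phi, if_pos hm, if_neg hn.not_gt, if_pos hn]
      rw [ca]
      congr 1
      simp only [eq_iff_iff]
      omega
    · omega
    · have h0 := create_anticomm 0 0
      have h1 := annih_anticomm 0 0
      have h2 := create_annih_anticomm 0 0
      have h0' : create 0 * create 0 = 0 := by
        rw [← two_smul ℂ] at h0; exact (smul_eq_zero.1 h0).resolve_left two_ne_zero
      have h1' : annih 0 * annih 0 = 0 := by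
        rw [← two_smul ℂ] at h1; exact (smul_eq_zero.1 h1).resolve_left two_ne_zero
      simp only [if_true] at h2
      simp only [phi_zero, neg_zero, if_true, mul_add, add_mul, mul_smul_comm, smul_mul_assoc,
        h0', h1', smul_zero, zero_add, add_zero, ← h2]
      module
    · rw [if_neg (by omega)]
      rw [if_neg (by omega)] at ca
      simp only [Int.natAbs_zero] at aa ca
      simp only [phi, if_neg hn.not_gt, if_pos hn, lt_irrefl, if_false, mul_add, add_mul,
        mul_smul_comm, smul_mul_assoc]
      rw [add_add_add_comm, ca, ← smul_add, aa, smul_zero, add_zero]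
    · omega
    · omega
    · rw [if_neg (by omega)]
      simpa [phi, hm, hn, hm.not_gt, hn.not_gt] using aa
  rcases le_total m n with h | h
  · exact key m n h
  · rw [add_comm, key n m h]
    congr 1
    simp only [eq_iff_iff]
    omega

/-- `φ_n |0⟩ = 0` for `n > 0`. -/
theorem phi_vac {n : ℤ} (hn : 0 < n) : phi n vac = 0 := by
  lift n to ℕ using hn.le
  rw [phi_pos (by exact_mod_cast hn), vac, annih_e]
  simp

/-- The basis vector of `S = {s₁ > ⋯ > sₘ}` is `φ_{-s₁} ⋯ φ_{-sₘ} |0⟩`. -/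
theorem prod_phi_vac (S : Finset ℕ) :
    ((S.sort (· ≥ ·)).map fun s : ℕ => phi (-(s : ℤ))).prod vac = e S := by
  induction S using Finset.induction_on_max with
  | empty => simp [vac]
  | insert n S hn ih =>
    have hnS : n ∉ S := fun h => lt_irrefl _ (hn n h)
    rw [Finset.sort_insert (r := (· ≥ ·)) (fun b hb => (hn b hb).le) hnS]
    have hs : S.filter (fun s => n < s) = ∅ := by
      ext s; simp only [Finset.mem_filter, Finset.notMem_empty, iff_false, not_and]
      exact fun h => (hn s h).not_gt
    rw [List.map_cons, List.prod_cons, Module.End.mul_apply, ih]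
    rcases Nat.eq_zero_or_pos n with rfl | hpos
    · simp [phi_zero, create_e, annih_e, hnS, sgn, hs]
    · simp [phi_neg hpos, create_e, hnS, sgn, hs]

/-! ## The grading, the subspace `𝓕₀`, and the operators -/

/-- The weight `|λ|` of the basis vector `e S` (the element `0 ∈ S` does not contribute). -/
def weight (S : Finset ℕ) : ℕ := ∑ s ∈ S, s

/-- The grading operator `L₀`. -/
noncomputable def L0 : Module.End ℂ Fock :=
  Finsupp.linearCombination ℂ fun S => (weight S : ℂ) • e S

/-- The operator `q^{L₀}`. -/
noncomputable def qL0 (q : ℂ) : Module.End ℂ Fock :=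
  Finsupp.linearCombination ℂ fun S => q ^ weight S • e S

theorem L0_apply (v : Fock) (S : Finset ℕ) : L0 v S = weight S * v S := by
  induction v using Finsupp.induction_linear with
  | zero => simp
  | add v w hv hw => simp [hv, hw, mul_add]
  | single T c =>
    by_cases h : T = S
    · subst h; simp [L0, e, mul_comm]
    · simp [L0, e, Finsupp.single_eq_of_ne' h]

theorem qL0_apply (q : ℂ) (v : Fock) (S : Finset ℕ) : qL0 q v S = q ^ weight S * v S := by
  induction v using Finsupp.induction_linear with
  | zero => simp
  | add v w hv hw => simp [hv, hw, mul_add]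
  | single T c =>
    by_cases h : T = S
    · subst h; simp [qL0, e, mul_comm]
    · simp [qL0, e, Finsupp.single_eq_of_ne' h]

/-- `q^{L₀}` acts as `q^n` on the eigenspace of `L₀` with eigenvalue `n`. -/
theorem qL0_of_eigen (q : ℂ) (n : ℕ) (v : Fock) (hv : L0 v = (n : ℂ) • v) :
    qL0 q v = q ^ n • v := by
  ext S
  have h := DFunLike.congr_fun hv S
  rw [L0_apply, Finsupp.smul_apply, smul_eq_mul] at h
  rw [qL0_apply, Finsupp.smul_apply, smul_eq_mul]
  by_cases h0 : v S = 0
  · simp [h0]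
  · have : weight S = n := by exact_mod_cast mul_right_cancel₀ h0 h
    rw [this]

/-- The subspace `𝓕₀`, spanned by the `φ_λ` with `ℓ(λ)` even and the `φ_λ φ_0` with `ℓ(λ)` odd,
that is, by the `e S` with `#S` even. -/
noncomputable def F0 : Submodule ℂ Fock :=
  Submodule.span ℂ {v | ∃ S : Finset ℕ, Even S.card ∧ v = e S}

/-- The normally ordered product `:φ_{-i} φ_j:`, by which `E_{i,j} - E_{-j,-i}` acts. -/
noncomputable def normalPair (i j : ℤ) : Module.End ℂ Fock :=
  phi (-i) * phi j - (if i = j ∧ j < 0 then (1 : Module.End ℂ Fock) else 0)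

theorem normalPair_pos (k : ℕ) :
    normalPair ((k : ℤ) + 1) ((k : ℤ) + 1) = create (k + 1) * annih (k + 1) := by
  have h1 := phi_neg (Nat.succ_pos k)
  have h2 := phi_pos (Nat.succ_pos k)
  push_cast at h1 h2
  have h3 : ¬ ((k : ℤ) + 1 < 0) := by omega
  rw [normalPair, if_neg (fun h => h3 h.2), h1, h2]
  exact sub_zero (create (k + 1) * annih (k + 1))

theorem annih_finite (v : Fock) : {k : ℕ | annih k v ≠ 0}.Finite := by
  induction v using Finsupp.induction_linear with
  | zero => simp
  | add v w hv hw =>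
    refine (hv.union hw).subset fun k hk => ?_
    by_contra h
    simp only [Set.mem_union, Set.mem_ofPred_eq, not_or, not_not] at h
    exact hk (by rw [map_add, h.1, h.2, add_zero])
  | single T c =>
    refine T.finite_toSet.subset fun k hk => ?_
    by_contra h
    exact hk (by simp [annih, show k ∉ T from h])

theorem normalPair_finite (v : Fock) :
    {k : ℕ | normalPair ((k : ℤ) + 1) ((k : ℤ) + 1) v ≠ 0}.Finite := by
  refine ((annih_finite v).preimage (Nat.succ_injective.injOn)).subset fun k hk h => hk ?_
  rw [normalPair_pos, Module.End.mul_apply, h, map_zero]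

/-- The coefficient `t^k - t^{-k}`. -/
noncomputable def coeff (t : ℂ) (k : ℕ) : ℂ := t ^ k - (t ^ k)⁻¹

theorem normalB0_finite (t : ℂ) (v : Fock) :
    (Function.support fun k : ℕ =>
      coeff t (k + 1) • normalPair ((k : ℤ) + 1) ((k : ℤ) + 1) v).Finite :=
  (normalPair_finite v).subset fun k hk h => hk (by simp [h])

/-- The operator `:𝓑₀(t): = ∑_{k ≥ 1} (t^k - t^{-k}) :φ_{-k} φ_k:` (here `k` is shifted by one);
on each vector only finitely many terms are nonzero. -/
noncomputable def normalB0 (t : ℂ) : Module.End ℂ Fock where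
  toFun v := ∑ᶠ k : ℕ, coeff t (k + 1) • normalPair ((k : ℤ) + 1) ((k : ℤ) + 1) v
  map_add' v w := by
    rw [← finsum_add_distrib (normalB0_finite t v) (normalB0_finite t w)]
    simp only [map_add, smul_add]
  map_smul' c v := by
    rw [RingHom.id_apply, smul_finsum' c (normalB0_finite t v)]
    simp only [map_smul, smul_comm c]

/-- The operator `𝓑₀(t) = :𝓑₀(t): + (t+1)/(2(t-1)) I`. -/
noncomputable def B0 (t : ℂ) : Module.End ℂ Fock :=
  normalB0 t + ((t + 1) / (2 * (t - 1))) • 1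

theorem normalB0_mem_F0 (t : ℂ) {v : Fock} (hv : v ∈ F0) : normalB0 t v ∈ F0 := by
  refine finsum_induction (· ∈ F0) F0.zero_mem (fun _ _ => F0.add_mem) fun k => ?_
  refine F0.smul_mem _ ?_
  rw [normalPair_pos]
  induction hv using Submodule.span_induction with
  | mem v hv =>
    obtain ⟨S, hS, rfl⟩ := hv
    by_cases h : k + 1 ∈ S
    · simp only [Module.End.mul_apply, annih_e, h, if_true, map_smul, create_e,
        Finset.notMem_erase, if_false, Finset.insert_erase h]
      exact F0.smul_mem _ (F0.smul_mem _ (Submodule.subset_span ⟨S, hS, rfl⟩))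
    · simp [annih_e, h]
  | zero => simp
  | add v w _ _ hv hw => rw [map_add]; exact F0.add_mem hv hw
  | smul c v _ hv => rw [map_smul]; exact F0.smul_mem c hv

theorem B0_mem_F0 (t : ℂ) {v : Fock} (hv : v ∈ F0) : B0 t v ∈ F0 :=
  F0.add_mem (normalB0_mem_F0 t hv) (F0.smul_mem _ hv)

theorem qL0_mem_F0 (q : ℂ) {v : Fock} (hv : v ∈ F0) : qL0 q v ∈ F0 := by
  induction hv using Submodule.span_induction with
  | mem v hv =>
    obtain ⟨S, hS, rfl⟩ := hv
    have h : qL0 q (e S) = q ^ weight S • e S := by simp [qL0, e]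
    rw [h]
    exact F0.smul_mem _ (Submodule.subset_span ⟨S, hS, rfl⟩)
  | zero => simp
  | add v w _ _ hv hw => rw [map_add]; exact F0.add_mem hv hw
  | smul c v _ hv => rw [map_smul]; exact F0.smul_mem c hv

/-! ## Traces and one-point functions -/

/-- The diagonal matrix entries of an operator in the homogeneous basis
`{e S : #S even}` of `𝓕₀`. -/
noncomputable def diagF0 (T : Module.End ℂ Fock) (S : {S : Finset ℕ // Even S.card}) : ℂ :=
  T (e S) S

/-- The trace over `𝓕₀` of an operator preserving `𝓕₀`: the sum of its diagonal entries
(meaningful when the entries are absolutely summable). -/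
noncomputable def traceF0 (T : Module.End ℂ Fock) : ℂ := ∑' S, diagF0 T S

/-- The normally ordered one-point function `:R:(t) = Tr_{𝓕₀} q^{L₀} :𝓑₀(t):`. -/
noncomputable def normalR (q t : ℂ) : ℂ := traceF0 (qL0 q * normalB0 t)

/-- The one-point function `R(t) = Tr_{𝓕₀} q^{L₀} 𝓑₀(t)`. -/
noncomputable def R (q t : ℂ) : ℂ := traceF0 (qL0 q * B0 t)

/-! ## `q`-products, theta functions, branches of the logarithm -/

/-- `(a;q)_∞ = ∏_{i ≥ 0} (1 - a q^i)`. -/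
noncomputable def qPoch (a q : ℂ) : ℂ := ∏' i : ℕ, (1 - a * q ^ i)

theorem qPoch_multipliable (a : ℂ) {q : ℂ} (hq : ‖q‖ < 1) :
    Multipliable fun i : ℕ => 1 - a * q ^ i := by
  simp only [sub_eq_add_neg]
  refine multipliable_one_add_of_summable ?_
  simp only [norm_neg, norm_mul, norm_pow]
  exact (summable_geometric_of_lt_one (norm_nonneg q) hq).mul_left _

/-- The theta function `θ_{j,1}(q,t) = ∑_{n ∈ j/2 + ℤ} q^{n²} t^n`.  As `q^{n²}` and `t^n` are
multivalued for `n ∈ 1/2 + ℤ`, it is a function of logarithms `a` of `q` and `u` of `t`. -/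
noncomputable def theta (j : ℕ) (a u : ℂ) : ℂ :=
  ∑' n : ℤ, Complex.exp (((n : ℂ) + j / 2) ^ 2 * a) * Complex.exp (((n : ℂ) + j / 2) * u)

theorem theta_summable (j : ℕ) {a : ℂ} (ha : ‖Complex.exp a‖ < 1) (u : ℂ) :
    Summable fun n : ℤ =>
      Complex.exp (((n : ℂ) + j / 2) ^ 2 * a) * Complex.exp (((n : ℂ) + j / 2) * u) := by
  have hpi : (Real.pi : ℂ) ≠ 0 := by exact_mod_cast Real.pi_ne_zero
  have hI := Complex.I_ne_zero
  have him : 0 < (a / (Real.pi * Complex.I)).im := by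
    have hre : a.re < 0 := by simpa [Complex.norm_exp] using ha
    have h : a / (Real.pi * Complex.I) = ((Real.pi⁻¹ : ℝ) : ℂ) * (-(a * Complex.I)) := by
      push_cast
      field_simp
      rw [Complex.I_sq]; ring
    rw [h, Complex.im_ofReal_mul]
    have : 0 < -a.re := by linarith
    simpa using mul_pos (inv_pos.2 Real.pi_pos) this
  have := ((summable_jacobiTheta₂_term_iff ((j * a + u) / (2 * Real.pi * Complex.I))
    (a / (Real.pi * Complex.I))).2 him).mul_left (Complex.exp ((j / 2 : ℂ) ^ 2 * a + j / 2 * u))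
  refine this.congr fun n => ?_
  rw [jacobiTheta₂_term, ← Complex.exp_add, ← Complex.exp_add]
  congr 1
  field_simp
  ring

/-- `ℓ` is a holomorphic branch of `log f` near the point `t`. -/
def IsLogBranchAt (f ℓ : ℂ → ℂ) (t : ℂ) : Prop :=
  AnalyticAt ℂ ℓ t ∧ ∀ᶠ z in 𝓝 t, Complex.exp (ℓ z) = f z

/-- Branches of `z ↦ log (-z)` exist near every nonzero point. -/
theorem exists_isLogBranchAt_neg {t : ℂ} (ht : t ≠ 0) :
    ∃ L : ℂ → ℂ, IsLogBranchAt (fun z => -z) L t := by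
  refine ⟨fun z => Complex.log (z / t) + Complex.log (-t), ?_, ?_⟩
  · refine AnalyticAt.add (AnalyticAt.clog (by fun_prop) ?_) analyticAt_const
    simp [div_self ht]
  · filter_upwards [isOpen_ne.mem_nhds ht] with z hz
    rw [Complex.exp_add, Complex.exp_log (div_ne_zero hz ht), Complex.exp_log (neg_ne_zero.2 ht)]
    field_simp

/-- `𝔹(q,t) = θ_{1,1}(q,-t) / θ_{0,1}(q,-t)`, for a logarithm `a` of `q` and a branch `L` of
`t ↦ log (-t)`. -/
noncomputable def thetaRatio (a : ℂ) (L : ℂ → ℂ) (t : ℂ) : ℂ :=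
  theta 1 a (L t) / theta 0 a (L t)

end RamondFock

namespace RamondFock

open Filter Topology

/-! ## Sums over finite subsets -/

section FinsetSums

variable {ι 𝕜 : Type*} [DecidableEq ι] [RCLike 𝕜]

/-! The parity condition defining `F0` decides whether the zero mode is occupied, so the basis of
`F0` is indexed by strict partitions, i.e. by all finite sets of positive integers (`evenEquiv`).
Both operators are diagonal there, and the trace becomes the sum over s of (∏ q^n)(∑ (t^n -
t^{-n})), with n running over s. Exchanging the two sums isolates the sets containing a fixed n;
these contribute the fraction q^n/(1+q^n) of the full product (-q;q)_∞ (`hasSum_prod_mul_sum`). This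
is the first series. Expanding 1/(1+q^n) geometrically and summing over n first gives the second
(`lambert_swap`).

For R(t), both theta functions are factored by the Jacobi triple product, proved here as the limit
of its finite form with central Gaussian binomials. In 𝔹(q,t) the factor (q²;q²)_∞ cancels, leaving
exp(a/4 + L/2) times a quotient of q²-products (`thetaRatio_eq`). Its logarithmic derivative is 1/2,
from (-t)^{1/2}, plus four Lambert series in q². Splitting the alternating series by the parity of r
produces the same Lambert series, except that the numerator factor 1 - t^{-1} has no counterpart.
Its contribution t^{-1}/(1-t^{-1}), together with 1/2, is exactly the constant (t+1)/(2(t-1)). -/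

theorem prod_update_zero (f : ι → 𝕜) (k : ι) (s : Finset ι) :
    ∏ i ∈ s, Function.update f k 0 i = if k ∈ s then 0 else ∏ i ∈ s, f i := by
  split_ifs with h
  · exact Finset.prod_eq_zero h (by simp)
  · exact Finset.prod_congr rfl fun i hi =>
      Function.update_of_ne (ne_of_mem_of_not_mem hi h) _ _

/-- The sum of `∏_{i ∈ s} f i` over the finite sets `s` containing `k`. -/
theorem hasSum_prod_of_mem {f : ι → 𝕜} (hf : Summable fun i => ‖f i‖) (k : ι) (hk : 1 + f k ≠ 0) :
    HasSum (fun s : Finset ι => if k ∈ s then ∏ i ∈ s, f i else 0)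
      (f k / (1 + f k) * ∏' i, (1 + f i)) := by
  have hf' : Summable fun i => ‖Function.update f k 0 i‖ := by
    refine hf.of_nonneg_of_le (fun _ => norm_nonneg _) fun i => ?_
    rcases eq_or_ne i k with rfl | h
    · simp
    · simp [h]
  have h1 := (summable_finsetProd_of_summable_norm hf).hasSum
  have h2 := (summable_finsetProd_of_summable_norm hf').hasSum
  have p1 := hasProd_one_add_of_hasSum_prod h1
  have p2 := hasProd_one_add_of_hasSum_prod h2
  have hu : (fun i => 1 + Function.update f k 0 i) = Function.update (fun i => 1 + f i) k 1 := by
    funext i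
    rcases eq_or_ne i k with rfl | h
    · simp
    · simp [h]
  rw [hu] at p2
  -- Replacing the factor `1 + f k` by 1 yields the sum over the sets avoiding `k`; the sets
  -- containing `k` give the difference from the full product.
  have h3 := p1.update' k 1 p2
  rw [p1.tprod_eq]
  convert! h1.sub h2 using 1
  · funext s
    rw [prod_update_zero]
    split_ifs <;> simp
  · rw [mul_one] at h3
    rw [h3]
    field_simp
    ring

/-- Summing `∏_{i ∈ s} f i * ∑_{i ∈ s} c i` over all finite sets `s`. -/
theorem hasSum_prod_mul_sum {f c : ι → 𝕜} (hf : Summable fun i => ‖f i‖)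
    (hc : Summable fun i => ‖f i * c i‖) (h1 : ∀ i, 1 + f i ≠ 0) :
    HasSum (fun s : Finset ι => (∏ i ∈ s, f i) * ∑ i ∈ s, c i)
      ((∏' i, (1 + f i)) * ∑' i, f i * c i / (1 + f i)) := by
  have hP : 0 ≤ ∏' i, (1 + ‖f i‖) := by
    rw [tprod_one_add (summable_finsetProd_of_summable_nonneg (fun _ => norm_nonneg _) hf)]
    exact tsum_nonneg fun s => Finset.prod_nonneg fun _ _ => norm_nonneg _
  -- The incidence sum over pairs `k ∈ s`. Absolute summability comes from the previous lemma
  -- applied to `‖f‖`, and then both orders of summation are available.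
  let F : ι × Finset ι → 𝕜 := fun p => c p.1 * if p.1 ∈ p.2 then ∏ i ∈ p.2, f i else 0
  have hn : ∀ k, HasSum (fun s => ‖F (k, s)‖)
      (‖c k‖ * (‖f k‖ / (1 + ‖f k‖) * ∏' i, (1 + ‖f i‖))) := by
    intro k
    have h := (hasSum_prod_of_mem (f := fun i => ‖f i‖) (by simpa using hf) k
      (by positivity)).mul_left ‖c k‖
    refine h.congr_fun fun s => ?_
    simp only [F]
    split_ifs <;> simp
  have hF : Summable F := by
    refine Summable.of_norm ((summable_prod_of_nonneg fun _ => norm_nonneg _).2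
      ⟨fun k => (hn k).summable, ?_⟩)
    simp only [(hn _).tsum_eq]
    refine (hc.mul_right (∏' i, (1 + ‖f i‖))).of_nonneg_of_le (fun k => by positivity) fun k => ?_
    rw [norm_mul, mul_comm ‖f k‖, mul_assoc]
    gcongr
    exact div_le_self (norm_nonneg _) (by simp)
  have hfib : ∀ k, HasSum (fun s => F (k, s)) (c k * (f k / (1 + f k) * ∏' i, (1 + f i))) :=
    fun k => (hasSum_prod_of_mem hf k (h1 k)).mul_left _
  have hS := (hF.hasSum.prod_fiberwise hfib)
  have hS' := (((Equiv.prodComm _ _).hasSum_iff (f := F)).2 hF.hasSum).prod_fiberwise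
    (g := fun s => (∏ i ∈ s, f i) * ∑ i ∈ s, c i) fun s => by
      have : HasSum (fun k => F (k, s)) (∑ k ∈ s, F (k, s)) :=
        hasSum_sum_of_ne_finset_zero fun k hk => by simp [F, hk]
      convert! this using 1
      rw [Finset.mul_sum]
      exact Finset.sum_congr rfl fun k hk => by simp [F, hk, mul_comm]
  convert! hS' using 1
  rw [← hS.tsum_eq, ← tsum_mul_left]
  exact tsum_congr fun k => by ring

end FinsetSums

/-! ## The trace over `𝓕₀` -/

/-- Finite sets of natural numbers of even cardinality correspond to strict partitions: the parity
determines whether the zero mode is occupied.  The parts are shifted by one. -/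
noncomputable def evenEquiv : Finset ℕ ≃ {S : Finset ℕ // Even S.card} where
  toFun s := if h : Even s.card then ⟨s.map (addRightEmbedding 1), by simpa using h⟩
    else ⟨insert 0 (s.map (addRightEmbedding 1)), by
      rw [Finset.card_insert_of_notMem (by simp), Finset.card_map]
      exact (Nat.not_even_iff_odd.1 h).add_one⟩
  invFun S := S.1.preimage (· + 1) (add_left_injective 1).injOn
  left_inv s := by
    dsimp only
    split_ifs <;> ext i <;> simp
  right_inv S := by
    obtain ⟨S, hS⟩ := S
    have hmap : (S.preimage (· + 1) (add_left_injective 1).injOn).map (addRightEmbedding 1)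
        = S.erase 0 := by
      ext i
      cases i <;> simp
    have hcard := congrArg Finset.card hmap
    rw [Finset.card_map] at hcard
    by_cases h0 : 0 ∈ S
    · have hodd : ¬ Even (S.preimage (· + 1) (add_left_injective 1).injOn).card := by
        rw [hcard, ← Nat.even_add_one, Finset.card_erase_add_one h0]
        exact hS
      simp only [dif_neg hodd]
      exact Subtype.ext ((congrArg (insert 0) hmap).trans (Finset.insert_erase h0))
    · rw [Finset.erase_eq_of_notMem h0] at hcard hmap
      have heven : Even (S.preimage (· + 1) (add_left_injective 1).injOn).card := by
        rw [hcard]; exact hS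
      simp only [dif_pos heven]
      exact Subtype.ext hmap

theorem succ_mem_evenEquiv (s : Finset ℕ) (k : ℕ) : k + 1 ∈ (evenEquiv s).1 ↔ k ∈ s := by
  unfold evenEquiv
  simp only [Equiv.coe_fn_mk]
  split_ifs <;> simp

theorem weight_evenEquiv (s : Finset ℕ) : weight (evenEquiv s).1 = ∑ i ∈ s, (i + 1) := by
  unfold evenEquiv weight
  simp only [Equiv.coe_fn_mk]
  split_ifs
  · simp
  · simp only
    rw [Finset.sum_insert (by simp)]
    simp

/-- This is the occupation number operator of mode `k + 1`: the signs of removal and reinsertion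
agree and square to 1. -/
theorem normalPair_e (k : ℕ) (S : Finset ℕ) :
    normalPair ((k : ℤ) + 1) ((k : ℤ) + 1) (e S) = if k + 1 ∈ S then e S else 0 := by
  rw [normalPair_pos, Module.End.mul_apply, annih_e]
  split_ifs with h
  · rw [map_smul, create_e, if_neg (Finset.notMem_erase _ _), smul_smul, Finset.insert_erase h,
      sgn_erase h, if_neg (lt_irrefl _), sgn_mul_self, one_smul]
  · simp

theorem diagF0_normalB0 (q t : ℂ) (s : Finset ℕ) :
    diagF0 (qL0 q * normalB0 t) (evenEquiv s) =
      (∏ i ∈ s, q ^ (i + 1)) * ∑ i ∈ s, coeff t (i + 1) := by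
  have h : normalB0 t (e (evenEquiv s).1) = (∑ i ∈ s, coeff t (i + 1)) • e (evenEquiv s).1 := by
    change (∑ᶠ k : ℕ, coeff t (k + 1) • normalPair ((k : ℤ) + 1) ((k : ℤ) + 1) _) = _
    simp only [normalPair_e, succ_mem_evenEquiv]
    rw [finsum_eq_sum_of_support_subset (s := s), Finset.sum_smul]
    · exact Finset.sum_congr rfl fun i hi => by rw [if_pos hi]
    · intro k hk
      by_contra h
      exact hk (by simp [show k ∉ s from h])
  rw [diagF0, Module.End.mul_apply, h, qL0_apply, weight_evenEquiv, Finset.prod_pow_eq_pow_sum]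
  simp [e]

theorem diagF0_B0 (q t : ℂ) (s : Finset ℕ) :
    diagF0 (qL0 q * B0 t) (evenEquiv s) = diagF0 (qL0 q * normalB0 t) (evenEquiv s) +
      (∏ i ∈ s, q ^ (i + 1)) * ((t + 1) / (2 * (t - 1))) := by
  rw [diagF0, B0, mul_add, LinearMap.add_apply, Finsupp.add_apply, diagF0, mul_smul_comm,
    mul_one, LinearMap.smul_apply, Finsupp.smul_apply, qL0_apply, weight_evenEquiv,
    Finset.prod_pow_eq_pow_sum]
  simp [e, mul_comm]

theorem one_add_pow_ne_zero {q : ℂ} (hq : ‖q‖ < 1) (n : ℕ) : 1 + q ^ (n + 1) ≠ 0 := by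
  intro h
  have h1 : q ^ (n + 1) = -1 := by linear_combination h
  have h2 : ‖q‖ ^ (n + 1) = 1 := by rw [← norm_pow, h1]; simp
  exact (pow_lt_one₀ (norm_nonneg q) hq n.succ_ne_zero).ne h2

theorem qPoch_neg_self (q : ℂ) : qPoch (-q) q = ∏' i : ℕ, (1 + q ^ (i + 1)) := by
  unfold qPoch
  exact tprod_congr fun i => by ring

theorem summable_norm_pow_succ {x : ℂ} (hx : ‖x‖ < 1) : Summable fun n : ℕ => ‖x ^ (n + 1)‖ := by
  simp only [norm_pow]
  exact (summable_nat_add_iff 1).2 (summable_geometric_of_lt_one (norm_nonneg x) hx)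

/-! ### The trace as a Lambert series -/

section OnePoint

variable {q t : ℂ}

/-- The terms are (qt)^n - (q/t)^n, so the annulus condition on t gives two geometric majorants. -/
theorem summable_norm_pow_mul_coeff (hqt : ‖q * t⁻¹‖ < 1) (htq : ‖q * t‖ < 1) :
    Summable fun n : ℕ => ‖q ^ (n + 1) * coeff t (n + 1)‖ := by
  refine ((summable_norm_pow_succ htq).add (summable_norm_pow_succ hqt)).of_nonneg_of_le
    (fun _ => norm_nonneg _) fun n => ?_
  rw [coeff, mul_sub, ← inv_pow, ← mul_pow, ← mul_pow]
  exact norm_sub_le _ _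

theorem hasSum_diagF0_normalB0 (hq : ‖q‖ < 1) (hqt : ‖q * t⁻¹‖ < 1) (htq : ‖q * t‖ < 1) :
    HasSum (diagF0 (qL0 q * normalB0 t))
      (qPoch (-q) q * ∑' n : ℕ, q ^ (n + 1) * coeff t (n + 1) / (1 + q ^ (n + 1))) := by
  rw [← evenEquiv.hasSum_iff, qPoch_neg_self]
  have := hasSum_prod_mul_sum (summable_norm_pow_succ hq) (summable_norm_pow_mul_coeff hqt htq)
    (one_add_pow_ne_zero hq)
  exact this.congr_fun (diagF0_normalB0 q t)

theorem hasSum_diagF0_B0 (hq : ‖q‖ < 1) (hqt : ‖q * t⁻¹‖ < 1) (htq : ‖q * t‖ < 1) :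
    HasSum (diagF0 (qL0 q * B0 t))
      (qPoch (-q) q * (∑' n : ℕ, q ^ (n + 1) * coeff t (n + 1) / (1 + q ^ (n + 1)) +
        (t + 1) / (2 * (t - 1)))) := by
  have h1 := evenEquiv.hasSum_iff.2 (hasSum_diagF0_normalB0 hq hqt htq)
  have hs := summable_finsetProd_of_summable_norm (summable_norm_pow_succ hq)
  have h2 := hs.hasSum.mul_right ((t + 1) / (2 * (t - 1)))
  rw [← tprod_one_add hs, ← qPoch_neg_self] at h2
  rw [← evenEquiv.hasSum_iff, mul_add]
  exact (h1.add h2).congr_fun (diagF0_B0 q t)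

theorem one_sub_pow_mul_ne_zero {x : ℂ} (hq : ‖q‖ < 1) (hx : ‖q * x‖ < 1) (r : ℕ) :
    1 - q ^ (r + 1) * x ≠ 0 := by
  intro h
  have h1 : q ^ r * (q * x) = 1 := by linear_combination -h
  have h2 : ‖q‖ ^ r * ‖q * x‖ = 1 := by rw [← norm_pow, ← norm_mul, h1]; simp
  have h3 : ‖q‖ ^ r ≤ 1 := pow_le_one₀ (norm_nonneg q) hq.le
  nlinarith [norm_nonneg (q * x)]

/-- The expansion of `x^n q^n / (1 + q^n)` into a double series, summed in both orders. -/
theorem lambert_swap {x : ℂ} (hq : ‖q‖ < 1) (hx : ‖q * x‖ < 1) :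
    (Summable fun n : ℕ => (q * x) ^ (n + 1) / (1 + q ^ (n + 1))) ∧
    (Summable fun r : ℕ => (-1) ^ r * q ^ (r + 1) * x / (1 - q ^ (r + 1) * x)) ∧
    ∑' n : ℕ, (q * x) ^ (n + 1) / (1 + q ^ (n + 1)) =
      ∑' r : ℕ, (-1) ^ r * q ^ (r + 1) * x / (1 - q ^ (r + 1) * x) := by
  let F : ℕ × ℕ → ℂ := fun p => (q * x) ^ (p.1 + 1) * (-q ^ (p.1 + 1)) ^ p.2
  have hF : Summable F := by
    -- Since |q^{n+1}| ≤ |q|, the double series is dominated by the product of the geometric series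
    -- of `q * x` and `q`.
    refine Summable.of_norm_bounded
      ((summable_norm_pow_succ hx).mul_of_nonneg (summable_geometric_of_lt_one (norm_nonneg q) hq)
        (fun _ => norm_nonneg _) fun _ => by positivity) fun p => ?_
    simp only [F, norm_mul, norm_pow, norm_neg]
    gcongr
    rw [pow_succ]
    exact mul_le_of_le_one_left (norm_nonneg q) (pow_le_one₀ (norm_nonneg q) hq.le)
  have h1 : ∀ n, HasSum (fun r => F (n, r)) ((q * x) ^ (n + 1) / (1 + q ^ (n + 1))) := by
    intro n
    have : ‖-q ^ (n + 1)‖ < 1 := by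
      rw [norm_neg, norm_pow]; exact pow_lt_one₀ (norm_nonneg q) hq n.succ_ne_zero
    have h := (hasSum_geometric_of_norm_lt_one this).mul_left ((q * x) ^ (n + 1))
    rwa [sub_neg_eq_add, ← div_eq_mul_inv] at h
  have h2 : ∀ r, HasSum (fun n => F (n, r))
      ((-1) ^ r * q ^ (r + 1) * x / (1 - q ^ (r + 1) * x)) := by
    intro r
    have hlt : ‖q ^ (r + 1) * x‖ < 1 := by
      rw [pow_succ, mul_assoc, norm_mul, norm_pow]
      exact (mul_le_of_le_one_left (norm_nonneg _) (pow_le_one₀ (norm_nonneg q) hq.le)).trans_lt hx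
    have h := (hasSum_geometric_of_norm_lt_one hlt).mul_left ((-1) ^ r * q ^ (r + 1) * x)
    rw [← div_eq_mul_inv] at h
    refine h.congr_fun fun n => ?_
    simp only [F]
    rw [neg_pow (q ^ (n + 1))]
    ring
  have s1 := hF.hasSum.prod_fiberwise h1
  have s2 := (((Equiv.prodComm _ _).hasSum_iff (f := F)).2 hF.hasSum).prod_fiberwise
    (f := F ∘ Equiv.prodComm _ _) h2
  exact ⟨s1.summable, s2.summable, s1.tsum_eq.trans s2.tsum_eq.symm⟩

end OnePoint

/-! ## The Jacobi triple product -/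

/-- The finite product `(Q;Q)_k = ∏_{i=1}^k (1 - Q^i)`. -/
noncomputable def qFac (Q : ℂ) (k : ℕ) : ℂ := ∏ i ∈ Finset.range k, (1 - Q ^ (i + 1))

/-- The function `k ↦ 1 / (Q;Q)_k`, extended by zero to negative `k`. -/
noncomputable def invFac (Q : ℂ) (k : ℤ) : ℂ := if k < 0 then 0 else (qFac Q k.toNat)⁻¹

/-- The central `Q`-binomial coefficient `[2N, N+n]`. -/
noncomputable def centralBinom (Q : ℂ) (N : ℕ) (n : ℤ) : ℂ :=
  qFac Q (2 * N) * invFac Q (N - n) * invFac Q (N + n)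

section

variable {Q : ℂ}

theorem one_sub_pow_ne_zero (hQ : ‖Q‖ < 1) (n : ℕ) : 1 - Q ^ (n + 1) ≠ 0 := by
  simpa using one_sub_pow_mul_ne_zero (x := 1) hQ (by simpa using hQ) n

theorem qFac_ne_zero (hQ : ‖Q‖ < 1) (k : ℕ) : qFac Q k ≠ 0 :=
  Finset.prod_ne_zero_iff.2 fun i _ => one_sub_pow_ne_zero hQ i

theorem qFac_succ (k : ℕ) : qFac Q (k + 1) = qFac Q k * (1 - Q ^ (k + 1)) :=
  Finset.prod_range_succ _ _

theorem invFac_natCast (k : ℕ) : invFac Q k = (qFac Q k)⁻¹ := by simp [invFac]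

theorem invFac_of_neg {k : ℤ} (hk : k < 0) : invFac Q k = 0 := by simp [invFac, hk]

/-- Extension by zero makes the recursion valid for every integer: at `k = 0` the factor `1 - Q ^ k`
vanishes. -/
theorem invFac_sub_one (hQ : ‖Q‖ < 1) (k : ℤ) : invFac Q (k - 1) = invFac Q k * (1 - Q ^ k) := by
  rcases lt_trichotomy k 0 with hk | rfl | hk
  · rw [invFac_of_neg hk, invFac_of_neg (by omega), zero_mul]
  · rw [invFac_of_neg (by omega)]; simp
  · obtain ⟨m, rfl⟩ : ∃ m : ℕ, k = (m + 1 : ℕ) := ⟨(k - 1).toNat, by omega⟩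
    rw [show ((m + 1 : ℕ) : ℤ) - 1 = (m : ℕ) by push_cast; ring, invFac_natCast, invFac_natCast,
      qFac_succ, zpow_natCast]
    have := one_sub_pow_ne_zero hQ m
    have := qFac_ne_zero hQ m
    field_simp

theorem tendsto_qFac (hQ : ‖Q‖ < 1) : Tendsto (qFac Q) atTop (𝓝 (qPoch Q Q)) := by
  have h := (qPoch_multipliable Q hQ).hasProd.tendsto_prod_nat
  refine h.congr fun k => Finset.prod_congr rfl fun i _ => ?_
  ring

theorem qPoch_ne_zero {x : ℂ} (hQ : ‖Q‖ < 1) (h : ∀ i : ℕ, 1 - x * Q ^ i ≠ 0) :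
    qPoch x Q ≠ 0 := by
  unfold qPoch
  simp only [sub_eq_add_neg] at h ⊢
  refine tprod_one_add_ne_zero_of_summable h ?_
  simp only [norm_neg, norm_mul, norm_pow]
  exact (summable_geometric_of_lt_one (norm_nonneg Q) hQ).mul_left _

theorem qPoch_self_ne_zero (hQ : ‖Q‖ < 1) : qPoch Q Q ≠ 0 :=
  qPoch_ne_zero hQ fun i => by
    rw [← pow_succ']; exact one_sub_pow_ne_zero hQ i

theorem tendsto_invFac (hQ : ‖Q‖ < 1) : Tendsto (invFac Q) atTop (𝓝 (qPoch Q Q)⁻¹) := by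
  have h : Tendsto Int.toNat atTop atTop :=
    tendsto_atTop.2 fun b => (eventually_ge_atTop (b : ℤ)).mono fun k hk => by omega
  refine (((tendsto_qFac hQ).inv₀ (qPoch_self_ne_zero hQ)).comp h).congr' ?_
  filter_upwards [eventually_ge_atTop 0] with k hk
  simp [invFac, hk.not_gt]

/-- Convergent sequences are bounded, so `qFac` and its inverse are; the uniform bound serves
dominated convergence in the triple product. -/
theorem exists_norm_centralBinom_le (hQ : ‖Q‖ < 1) : ∃ C, ∀ N n, ‖centralBinom Q N n‖ ≤ C := by
  obtain ⟨A, hA⟩ := (tendsto_qFac hQ).norm.bddAbove_range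
  obtain ⟨B, hB⟩ := ((tendsto_qFac hQ).inv₀ (qPoch_self_ne_zero hQ)).norm.bddAbove_range
  have hA' : ∀ k, ‖qFac Q k‖ ≤ A := fun k => hA ⟨k, rfl⟩
  have hB0 : 0 ≤ B := (norm_nonneg _).trans (hB ⟨0, rfl⟩)
  have hB' : ∀ k, ‖invFac Q k‖ ≤ B := fun k => by
    unfold invFac
    split_ifs
    · simpa using hB0
    · exact hB ⟨_, rfl⟩
  refine ⟨A * B * B, fun N n => ?_⟩
  have hA0 : 0 ≤ A := (norm_nonneg _).trans (hA' 0)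
  rw [centralBinom, norm_mul, norm_mul]
  gcongr
  exacts [hA' _, hB' _, hB' _]

theorem tendsto_centralBinom (hQ : ‖Q‖ < 1) (n : ℤ) :
    Tendsto (fun N => centralBinom Q N n) atTop (𝓝 (qPoch Q Q)⁻¹) := by
  have h0 := qPoch_self_ne_zero hQ
  have h1 := (tendsto_qFac hQ).comp (tendsto_id.const_mul_atTop' (r := 2) two_pos)
  have h2 := (tendsto_invFac hQ).comp
    (tendsto_atTop_add_const_right _ (-n) (tendsto_natCast_atTop_atTop (R := ℤ)))
  have h3 := (tendsto_invFac hQ).comp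
    (tendsto_atTop_add_const_right _ n (tendsto_natCast_atTop_atTop (R := ℤ)))
  convert! (h1.mul h2).mul h3 using 2
  field_simp

end

/-! ### The triple product: finite form and limit -/

section

variable {q : ℂ}

/-- Compares coefficients of x^n when the product is multiplied by its next factor (1 + xq^{2N+1})(1
+ x^{-1}q^{2N+1}) = 1 + q^{4N+2} + (x + x^{-1})q^{2N+1}. -/
theorem centralBinom_succ (hq : ‖q‖ < 1) (h0 : q ≠ 0) (N : ℕ) (n : ℤ) :
    centralBinom (q ^ 2) (N + 1) n * q ^ (n ^ 2) =
      centralBinom (q ^ 2) N n * q ^ (n ^ 2) * (1 + q ^ (4 * N + 2)) +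
      centralBinom (q ^ 2) N (n - 1) * q ^ ((n - 1) ^ 2) * q ^ (2 * N + 1) +
      centralBinom (q ^ 2) N (n + 1) * q ^ ((n + 1) ^ 2) * q ^ (2 * N + 1) := by
  have hQ : ‖q ^ 2‖ < 1 := by rw [norm_pow]; exact pow_lt_one₀ (norm_nonneg q) hq two_ne_zero
  have a1 : invFac (q ^ 2) (N - n) = invFac (q ^ 2) (N + 1 - n) * (1 - (q ^ 2) ^ (N + 1 - n)) := by
    rw [← invFac_sub_one hQ]; ring_nf
  have a2 : invFac (q ^ 2) (N - (n + 1)) = invFac (q ^ 2) (N - n) * (1 - (q ^ 2) ^ (N - n)) := by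
    rw [← invFac_sub_one hQ]; ring_nf
  have b1 : invFac (q ^ 2) (N + n) = invFac (q ^ 2) (N + 1 + n) * (1 - (q ^ 2) ^ (N + 1 + n)) := by
    rw [← invFac_sub_one hQ]; ring_nf
  have b2 : invFac (q ^ 2) (N + (n - 1)) = invFac (q ^ 2) (N + n) * (1 - (q ^ 2) ^ (N + n)) := by
    rw [← invFac_sub_one hQ]; ring_nf
  have e1 : q ^ ((n - 1) ^ 2) = q ^ (n ^ 2) * (q / (q ^ n * q ^ n)) := by
    rw [show (n - 1) ^ 2 = n ^ 2 + (1 - (n + n)) by ring, zpow_add₀ h0, zpow_sub₀ h0,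
      zpow_add₀ h0, zpow_one]
  have e2 : q ^ ((n + 1) ^ 2) = q ^ (n ^ 2) * (q * (q ^ n * q ^ n)) := by
    rw [show (n + 1) ^ 2 = n ^ 2 + (1 + (n + n)) by ring, zpow_add₀ h0, zpow_add₀ h0,
      zpow_add₀ h0, zpow_one]
  have f1 : qFac (q ^ 2) (2 * (N + 1)) =
      qFac (q ^ 2) (2 * N) * (1 - (q ^ 2) ^ (2 * N + 1)) * (1 - (q ^ 2) ^ (2 * N + 2)) := by
    rw [show 2 * (N + 1) = 2 * N + 1 + 1 by ring, qFac_succ, qFac_succ]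
  have hw : q ^ n ≠ 0 := zpow_ne_zero n h0
  have z1 : (q ^ 2) ^ ((N : ℤ) - n) = (q ^ N) ^ 2 / (q ^ n) ^ 2 := by
    rw [zpow_sub₀ (pow_ne_zero 2 h0), zpow_natCast, ← pow_mul, ← pow_mul, mul_comm 2 N,
      ← zpow_natCast q 2, ← zpow_natCast (q ^ n) 2, ← zpow_mul, ← zpow_mul, mul_comm n]
  have z2 : (q ^ 2) ^ ((N : ℤ) + n) = (q ^ N) ^ 2 * (q ^ n) ^ 2 := by
    rw [zpow_add₀ (pow_ne_zero 2 h0), zpow_natCast, ← pow_mul, ← pow_mul, mul_comm 2 N,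
      ← zpow_natCast q 2, ← zpow_natCast (q ^ n) 2, ← zpow_mul, ← zpow_mul, mul_comm n]
  have z3 : (q ^ 2) ^ ((N : ℤ) + 1 - n) = q ^ 2 * ((q ^ N) ^ 2 / (q ^ n) ^ 2) := by
    rw [← z1, show (N : ℤ) + 1 - n = 1 + (N - n) by ring, zpow_add₀ (pow_ne_zero 2 h0), zpow_one]
  have z4 : (q ^ 2) ^ ((N : ℤ) + 1 + n) = q ^ 2 * ((q ^ N) ^ 2 * (q ^ n) ^ 2) := by
    rw [← z2, show (N : ℤ) + 1 + n = 1 + (N + n) by ring, zpow_add₀ (pow_ne_zero 2 h0), zpow_one]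
  -- All terms are reduced to `invFac` at N+1-n and N+1+n; what remains is a rational identity in q,
  -- q^n and q^N.
  have a3 : (N : ℤ) - (n - 1) = N + 1 - n := by ring
  have b3 : (N : ℤ) + (n + 1) = N + 1 + n := by ring
  simp only [centralBinom]
  push_cast
  rw [a3, b3, a2, a1, b2, b1, e1, e2, f1, z1, z2, z3, z4,
    show q ^ (4 * N + 2) = (q ^ N) ^ 4 * q ^ 2 by ring,
    show q ^ (2 * N + 1) = (q ^ N) ^ 2 * q by ring,
    show (q ^ 2) ^ (2 * N + 1) = (q ^ N) ^ 4 * q ^ 2 by ring,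
    show (q ^ 2) ^ (2 * N + 2) = (q ^ N) ^ 4 * q ^ 4 by ring]
  generalize q ^ n = w at hw
  generalize q ^ N = s
  generalize invFac (q ^ 2) _ = A
  generalize invFac (q ^ 2) _ = B
  field_simp
  ring

/-- The finite form of the Jacobi triple product. -/
theorem hasSum_finite_triple_product (hq : ‖q‖ < 1) (h0 : q ≠ 0) {x : ℂ} (hx : x ≠ 0) (N : ℕ) :
    HasSum (fun n : ℤ => centralBinom (q ^ 2) N n * q ^ (n ^ 2) * x ^ n)
      (∏ i ∈ Finset.range N, ((1 + x * q ^ (2 * i + 1)) * (1 + x⁻¹ * q ^ (2 * i + 1)))) := by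
  induction N with
  | zero =>
    have h : ∀ n : ℤ, n ≠ 0 → centralBinom (q ^ 2) 0 n * q ^ (n ^ 2) * x ^ n = 0 := by
      intro n hn
      rcases hn.lt_or_gt with h | h
      · rw [centralBinom, invFac_of_neg (k := _ + n) (by simpa using h)]; simp
      · rw [centralBinom, invFac_of_neg (k := _ - n) (by simpa using h)]; simp
    simpa [centralBinom, invFac, qFac] using hasSum_single 0 h
  | succ N ih =>
    -- Multiplication by x or x^{-1} is an index shift in the bilateral sum.
    have hm := (Equiv.subRight (1 : ℤ)).hasSum_iff.2 ih
    have hp := (Equiv.addRight (1 : ℤ)).hasSum_iff.2 ih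
    have h := ((ih.mul_right (1 + q ^ (4 * N + 2))).add
      (hm.mul_right (x * q ^ (2 * N + 1)))).add (hp.mul_right (x⁻¹ * q ^ (2 * N + 1)))
    rw [Finset.prod_range_succ]
    convert! h using 1
    · funext n
      simp only [Function.comp_apply, Equiv.subRight_apply, Equiv.coe_addRight]
      rw [centralBinom_succ hq h0, zpow_sub_one₀ hx, zpow_add_one₀ hx]
      field_simp
    · field_simp
      ring

theorem summable_jacobi (hq : ‖q‖ < 1) (h0 : q ≠ 0) {x : ℂ} (hx : x ≠ 0) :
    Summable fun n : ℤ => q ^ (n ^ 2) * x ^ n := by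
  have h := theta_summable 0 (a := Complex.log q) (by rwa [Complex.exp_log h0]) (Complex.log x)
  refine h.congr fun n => ?_
  rw [mul_comm _ (Complex.log q), mul_comm _ (Complex.log x)]
  simp only [Nat.cast_zero, zero_div, add_zero]
  rw [← Int.cast_pow, mul_comm _ ((n ^ 2 : ℤ) : ℂ), mul_comm _ (n : ℂ), Complex.exp_int_mul,
    Complex.exp_int_mul, Complex.exp_log h0, Complex.exp_log hx]

/-- The Jacobi triple product. -/
theorem jacobi_triple_product (hq : ‖q‖ < 1) (h0 : q ≠ 0) {x : ℂ} (hx : x ≠ 0) :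
    ∑' n : ℤ, q ^ (n ^ 2) * x ^ n =
      qPoch (q ^ 2) (q ^ 2) * (qPoch (-(x * q)) (q ^ 2) * qPoch (-(x⁻¹ * q)) (q ^ 2)) := by
  have hQ : ‖q ^ 2‖ < 1 := by rw [norm_pow]; exact pow_lt_one₀ (norm_nonneg q) hq two_ne_zero
  have hP := qPoch_self_ne_zero hQ
  obtain ⟨C, hC⟩ := exists_norm_centralBinom_le hQ
  -- As N → ∞ each coefficient tends to 1/(q²;q²)_∞, while the uniform bound makes C|q^{n²}x^n| a
  -- summable majorant.
  have hlim := tendsto_tsum_of_dominated_convergence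
    (f := fun (N : ℕ) (n : ℤ) => centralBinom (q ^ 2) N n * q ^ (n ^ 2) * x ^ n)
    (g := fun n : ℤ => (qPoch (q ^ 2) (q ^ 2))⁻¹ * q ^ (n ^ 2) * x ^ n) (𝓕 := atTop)
    ((summable_jacobi hq h0 hx).norm.mul_left C)
    (fun n => ((tendsto_centralBinom hQ n).mul_const _).mul_const _)
    (Eventually.of_forall fun N n => by
      rw [mul_assoc, norm_mul]
      exact mul_le_mul_of_nonneg_right (hC N n) (norm_nonneg _))
  simp only [(hasSum_finite_triple_product hq h0 hx _).tsum_eq] at hlim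
  simp only [mul_assoc, tsum_mul_left] at hlim
  have hprod := (((qPoch_multipliable (-(x * q)) hQ).hasProd.mul
    (qPoch_multipliable (-(x⁻¹ * q)) hQ).hasProd)).tendsto_prod_nat
  have := tendsto_nhds_unique hlim (hprod.congr fun N => Finset.prod_congr rfl fun i _ => by ring)
  rw [inv_mul_eq_iff_eq_mul₀ hP] at this
  exact this

/-- The theta functions as bilateral power series. -/
theorem theta_eq_tsum (j : ℕ) (a u : ℂ) :
    theta j a u = Complex.exp ((j / 2) ^ 2 * a + j / 2 * u) *
      ∑' n : ℤ, Complex.exp a ^ (n ^ 2) * Complex.exp (u + j * a) ^ n := by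
  rw [theta, ← tsum_mul_left]
  refine tsum_congr fun n => ?_
  rw [← Complex.exp_int_mul, ← Complex.exp_int_mul, ← Complex.exp_add, ← Complex.exp_add,
    ← Complex.exp_add]
  congr 1
  push_cast
  ring

end

/-! ## Logarithmic derivatives -/

/-- The Lambert series `∑_{i ≥ 0} x Q^i / (1 - x Q^i)`. -/
noncomputable def lambert (x Q : ℂ) : ℂ := ∑' i : ℕ, x * Q ^ i / (1 - x * Q ^ i)

section

variable {x Q : ℂ}

/-- The denominators tend to 1, so the geometric series controls the tail. A vanishing denominator
gives the term 0 by convention, so no condition on `x` is needed. -/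
theorem summable_inv_one_sub (hQ : ‖Q‖ < 1) (x : ℂ) :
    Summable fun i : ℕ => Q ^ i / (1 - x * Q ^ i) := by
  have h1 : Tendsto (fun i : ℕ => (1 - x * Q ^ i)⁻¹) atTop (𝓝 1) := by
    have := ((((tendsto_pow_atTop_nhds_zero_of_norm_lt_one hQ).const_mul x).const_sub 1).inv₀
      (by simp))
    simpa using this
  have h2 : Summable fun i : ℕ => ‖Q ^ i‖ := by
    simpa only [norm_pow] using summable_geometric_of_lt_one (norm_nonneg Q) hQ
  rw [← Nat.cofinite_eq_atTop] at h1
  exact (h2.mul_tendsto_const h1).congr fun i => (div_eq_mul_inv _ _).symm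

theorem summable_lambert (hQ : ‖Q‖ < 1) (x : ℂ) :
    Summable fun i : ℕ => x * Q ^ i / (1 - x * Q ^ i) :=
  ((summable_inv_one_sub hQ x).mul_left x).congr fun _ => (mul_div_assoc _ _ _).symm

/-- Weierstrass M-test with majorant r|Q|^i; this yields holomorphy of `qPoch` and its termwise
logarithmic differentiation. -/
theorem hasProdLocallyUniformlyOn_qPoch (hQ : ‖Q‖ < 1) (r : ℝ) :
    HasProdLocallyUniformlyOn (fun (i : ℕ) x => 1 - x * Q ^ i) (fun x => qPoch x Q)
      (Metric.ball (0 : ℂ) r) := by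
  unfold qPoch
  simp only [sub_eq_add_neg]
  refine Summable.hasProdLocallyUniformlyOn_nat_one_add Metric.isOpen_ball
    ((summable_geometric_of_lt_one (norm_nonneg Q) hQ).mul_left r)
    (Eventually.of_forall fun n y hy => ?_) fun n => by fun_prop
  rw [norm_neg, norm_mul, norm_pow]
  have : ‖y‖ < r := by simpa using hy
  gcongr

theorem differentiable_qPoch (hQ : ‖Q‖ < 1) : Differentiable ℂ fun x => qPoch x Q := fun x => by
  refine ((hasProdLocallyUniformlyOn_qPoch hQ (‖x‖ + 1)).differentiableOn
    (.of_forall fun _ => ?_) Metric.isOpen_ball).differentiableAt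
    (Metric.isOpen_ball.mem_nhds (by simp))
  simpa [Finset.prod_fn] using DifferentiableOn.finsetProd (fun _ _ => by fun_prop)

theorem mul_logDeriv_qPoch (hQ : ‖Q‖ < 1) (h : ∀ i : ℕ, 1 - x * Q ^ i ≠ 0) :
    x * logDeriv (fun y => qPoch y Q) x = -lambert x Q := by
  have hd : ∀ i : ℕ, logDeriv (fun y : ℂ => 1 - y * Q ^ i) x = -(Q ^ i / (1 - x * Q ^ i)) := by
    intro i
    have : HasDerivAt (fun y : ℂ => 1 - y * Q ^ i) (-(1 * Q ^ i)) x :=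
      ((hasDerivAt_id x).mul_const _).const_sub 1
    rw [logDeriv_apply, this.deriv]
    ring
  have key := logDeriv_tprod_eq_tsum (f := fun (i : ℕ) (y : ℂ) => 1 - y * Q ^ i) (x := x)
    (s := Metric.ball 0 (‖x‖ + 1)) Metric.isOpen_ball (by simp) h (fun i => by fun_prop)
    (by simpa only [hd] using (summable_inv_one_sub hQ x).neg)
    (hasProdLocallyUniformlyOn_qPoch hQ _).multipliableLocallyUniformlyOn (qPoch_ne_zero hQ h)
  change logDeriv (fun y => qPoch y Q) x = _ at key
  simp only [hd] at key
  rw [key, tsum_neg, mul_neg, lambert, ← tsum_mul_left]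
  simp only [mul_div_assoc]

theorem mul_logDeriv_qPoch_mul (hQ : ‖Q‖ < 1) (c : ℂ) (h : ∀ i : ℕ, 1 - x * c * Q ^ i ≠ 0) :
    x * logDeriv (fun y => qPoch (y * c) Q) x = -lambert (x * c) Q := by
  have hd : HasDerivAt (fun y : ℂ => y * c) (1 * c) x := (hasDerivAt_id x).mul_const c
  have := logDeriv_comp (f := fun y => qPoch y Q) (g := fun y : ℂ => y * c) (x := x)
    (differentiable_qPoch hQ _) hd.differentiableAt
  rw [hd.deriv] at this
  rw [← mul_logDeriv_qPoch hQ h]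
  refine (congrArg (x * ·) this).trans ?_
  ring

theorem mul_logDeriv_qPoch_inv_mul (hQ : ‖Q‖ < 1) (hx : x ≠ 0) (c : ℂ)
    (h : ∀ i : ℕ, 1 - x⁻¹ * c * Q ^ i ≠ 0) :
    x * logDeriv (fun y => qPoch (y⁻¹ * c) Q) x = lambert (x⁻¹ * c) Q := by
  have hd : HasDerivAt (fun y : ℂ => y⁻¹ * c) (-(x ^ 2)⁻¹ * c) x := (hasDerivAt_inv hx).mul_const c
  have := logDeriv_comp (f := fun y => qPoch y Q) (g := fun y : ℂ => y⁻¹ * c) (x := x)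
    (differentiable_qPoch hQ _) hd.differentiableAt
  rw [hd.deriv] at this
  rw [← neg_neg (lambert _ _), ← mul_logDeriv_qPoch hQ h]
  refine (congrArg (x * ·) this).trans ?_
  field_simp

/-- Splits off the term `i = 0`; at x = t^{-1} it carries the pole at t = 1. -/
theorem lambert_eq_add (hQ : ‖Q‖ < 1) (x : ℂ) : lambert x Q = x / (1 - x) + lambert (x * Q) Q := by
  rw [lambert, (summable_lambert hQ x).tsum_eq_zero_add, lambert]
  simp only [pow_zero, mul_one, pow_succ', mul_assoc]

/-- Even `r` gives the odd powers of q with sign +, odd `r` the even powers with sign −. -/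
theorem tsum_alternating_eq_lambert {q : ℂ} (hq : ‖q‖ < 1) (x : ℂ) :
    ∑' r : ℕ, (-1) ^ r * q ^ (r + 1) * x / (1 - q ^ (r + 1) * x) =
      lambert (x * q) (q ^ 2) - lambert (x * q ^ 2) (q ^ 2) := by
  have hQ : ‖q ^ 2‖ < 1 := by rw [norm_pow]; exact pow_lt_one₀ (norm_nonneg q) hq two_ne_zero
  have e : ∀ i : ℕ, (-1) ^ (2 * i) * q ^ (2 * i + 1) * x / (1 - q ^ (2 * i + 1) * x) =
      x * q * (q ^ 2) ^ i / (1 - x * q * (q ^ 2) ^ i) := fun i => by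
    rw [pow_mul (-1 : ℂ)]; ring_nf
  have o : ∀ i : ℕ, (-1) ^ (2 * i + 1) * q ^ (2 * i + 1 + 1) * x / (1 - q ^ (2 * i + 1 + 1) * x) =
      -(x * q ^ 2 * (q ^ 2) ^ i / (1 - x * q ^ 2 * (q ^ 2) ^ i)) := fun i => by
    rw [pow_succ (-1 : ℂ), pow_mul (-1 : ℂ)]; ring_nf
  rw [← tsum_even_add_odd]
  · simp only [e, o]
    rw [tsum_neg, lambert, lambert, sub_eq_add_neg]
  · simpa only [e] using summable_lambert hQ _
  · simpa only [o] using (summable_lambert hQ _).neg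

end

/-! ### Logarithmic branches and the derivative of ln 𝔹 -/

section Branches

/-- Makes the final formula independent of the chosen branch. -/
theorem IsLogBranchAt.deriv_eq_logDeriv {f ℓ : ℂ → ℂ} {t : ℂ} (h : IsLogBranchAt f ℓ t) :
    deriv ℓ t = logDeriv f t := by
  have hd := h.1.differentiableAt.hasDerivAt.cexp
  have hf : (fun z => Complex.exp (ℓ z)) =ᶠ[𝓝 t] f := h.2
  rw [logDeriv_apply, ← hf.deriv_eq, ← hf.eq_of_nhds, hd.deriv,
    mul_div_cancel_left₀ _ (Complex.exp_ne_zero _)]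

theorem exists_isLogBranchAt {f : ℂ → ℂ} {t : ℂ} (hf : AnalyticAt ℂ f t) (h0 : f t ≠ 0) :
    ∃ ℓ, IsLogBranchAt f ℓ t := by
  -- Dividing by `f t` moves the value to 1, away from the cut of the principal logarithm.
  refine ⟨fun z => Complex.log (f z / f t) + Complex.log (f t), ?_, ?_⟩
  · refine AnalyticAt.add (AnalyticAt.clog (hf.div analyticAt_const h0) ?_) analyticAt_const
    simp [div_self h0]
  · filter_upwards [hf.continuousAt.eventually_ne h0] with z hz
    rw [Complex.exp_add, Complex.exp_log (div_ne_zero hz h0), Complex.exp_log h0,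
      div_mul_cancel₀ _ h0]

theorem IsLogBranchAt.congr {f g ℓ : ℂ → ℂ} {t : ℂ} (h : IsLogBranchAt f ℓ t)
    (hfg : f =ᶠ[𝓝 t] g) : IsLogBranchAt g ℓ t :=
  ⟨h.1, EventuallyEq.trans h.2 hfg⟩

theorem logDeriv_mul_mul_div_mul {f g h k l : ℂ → ℂ} {t : ℂ} (hf : f t ≠ 0) (hg : g t ≠ 0)
    (hh : h t ≠ 0) (hk : k t ≠ 0) (hl : l t ≠ 0) (df : DifferentiableAt ℂ f t)
    (dg : DifferentiableAt ℂ g t) (dh : DifferentiableAt ℂ h t) (dk : DifferentiableAt ℂ k t)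
    (dl : DifferentiableAt ℂ l t) :
    logDeriv (f * (g * h) / (k * l)) t =
      logDeriv f t + (logDeriv g t + logDeriv h t) - (logDeriv k t + logDeriv l t) := by
  have hgh : (g * h) t ≠ 0 := mul_ne_zero hg hh
  have hkl : (k * l) t ≠ 0 := mul_ne_zero hk hl
  have hfgh : (f * (g * h)) t ≠ 0 := mul_ne_zero hf hgh
  have h1 : logDeriv (f * (g * h) / (k * l)) t = _ :=
    logDeriv_div t hfgh hkl (df.mul (dg.mul dh)) (dk.mul dl)
  have h2 : logDeriv (f * (g * h)) t = _ := logDeriv_mul t hf hgh df (dg.mul dh)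
  have h3 : logDeriv (g * h) t = _ := logDeriv_mul t hg hh dg dh
  have h4 : logDeriv (k * l) t = _ := logDeriv_mul t hk hl dk dl
  rw [h1, h2, h3, h4]

/-- Product formula for `𝔹(q,t)`. -/
theorem thetaRatio_eq {q a z : ℂ} {L : ℂ → ℂ} (hq : ‖q‖ < 1) (ha : Complex.exp a = q) (hz : z ≠ 0)
    (hL : Complex.exp (L z) = -z) :
    thetaRatio a L z = Complex.exp (a / 4 + L z / 2) *
      (qPoch (z * q ^ 2) (q ^ 2) * qPoch (z⁻¹ * 1) (q ^ 2)) /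
      (qPoch (z * q) (q ^ 2) * qPoch (z⁻¹ * q) (q ^ 2)) := by
  have h0 : q ≠ 0 := ha ▸ Complex.exp_ne_zero a
  have hQ : ‖q ^ 2‖ < 1 := by rw [norm_pow]; exact pow_lt_one₀ (norm_nonneg q) hq two_ne_zero
  have hC := qPoch_self_ne_zero hQ
  -- The half-integer shift in the first theta function moves the triple product argument from -z to
  -- -zq.
  have e1 : Complex.exp (L z + (1 : ℕ) * a) = -z * q := by
    rw [Nat.cast_one, one_mul, Complex.exp_add, ha, hL]
  have e0 : Complex.exp (L z + (0 : ℕ) * a) = -z := by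
    rw [Nat.cast_zero, zero_mul, add_zero, hL]
  have s1 : -(-z * q * q) = z * q ^ 2 := by ring
  have s2 : -((-z * q)⁻¹ * q) = z⁻¹ * 1 := by field_simp
  have s3 : -(-z * q) = z * q := by ring
  have s4 : -((-z)⁻¹ * q) = z⁻¹ * q := by rw [inv_neg]; ring
  rw [thetaRatio, theta_eq_tsum, theta_eq_tsum, e1, e0, ha,
    jacobi_triple_product hq h0 (mul_ne_zero (neg_ne_zero.2 hz) h0),
    jacobi_triple_product hq h0 (neg_ne_zero.2 hz), s1, s2, s3, s4]
  have x1 : (((1 : ℕ) : ℂ) / 2) ^ 2 * a + ((1 : ℕ) : ℂ) / 2 * L z = a / 4 + L z / 2 := by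
    push_cast; ring
  rw [x1]
  simp only [Nat.cast_zero, zero_div, zero_mul, ne_eq, OfNat.ofNat_ne_zero, not_false_eq_true,
    zero_pow, add_zero, Complex.exp_zero, one_mul]
  rw [mul_left_comm, mul_div_mul_left _ _ hC]

theorem exists_branch_and_deriv_thetaRatio {q t a : ℂ} {L : ℂ → ℂ} (hq : ‖q‖ < 1)
    (hqt : ‖q * t⁻¹‖ < 1) (htq : ‖q * t‖ < 1) (ht : t ≠ 0) (ht1 : t ≠ 1) (ha : Complex.exp a = q)
    (hL : IsLogBranchAt (fun z => -z) L t) :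
    (∃ ℓ, IsLogBranchAt (thetaRatio a L) ℓ t) ∧
      t * logDeriv (thetaRatio a L) t = 1 / 2 + (-lambert (t * q ^ 2) (q ^ 2) +
        lambert (t⁻¹ * 1) (q ^ 2)) - (-lambert (t * q) (q ^ 2) + lambert (t⁻¹ * q) (q ^ 2)) := by
  have hQ : ‖q ^ 2‖ < 1 := by rw [norm_pow]; exact pow_lt_one₀ (norm_nonneg q) hq two_ne_zero
  have n1 : ∀ i : ℕ, 1 - t * q ^ 2 * (q ^ 2) ^ i ≠ 0 := fun i => by
    convert one_sub_pow_mul_ne_zero hq htq (2 * i + 1) using 1; ring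
  have n2 : ∀ i : ℕ, 1 - t * q * (q ^ 2) ^ i ≠ 0 := fun i => by
    convert one_sub_pow_mul_ne_zero hq htq (2 * i) using 1; ring
  have n3 : ∀ i : ℕ, 1 - t⁻¹ * q * (q ^ 2) ^ i ≠ 0 := fun i => by
    convert one_sub_pow_mul_ne_zero hq hqt (2 * i) using 1; ring
  -- The factor `i = 0` is 1 - t^{-1}, the only one whose nonvanishing requires `t ≠ 1`.
  have n4 : ∀ i : ℕ, 1 - t⁻¹ * 1 * (q ^ 2) ^ i ≠ 0
    | 0 => by
      intro h
      have : t⁻¹ = 1 := by linear_combination -h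
      exact ht1 (inv_eq_one.1 this)
    | i + 1 => by
      convert one_sub_pow_mul_ne_zero hq hqt (2 * i + 1) using 1; ring
  have a0 : AnalyticAt ℂ (fun z => Complex.exp (a / 4 + L z / 2)) t := by
    have := hL.1
    fun_prop
  have hP : ∀ y, AnalyticAt ℂ (fun x => qPoch x (q ^ 2)) y := fun y =>
    (differentiable_qPoch hQ).analyticAt y
  have a1 : ∀ c, AnalyticAt ℂ (fun z => qPoch (z * c) (q ^ 2)) t := fun c =>
    (hP (t * c)).comp (f := fun z => z * c) (by fun_prop)
  have a2 : ∀ c, AnalyticAt ℂ (fun z => qPoch (z⁻¹ * c) (q ^ 2)) t := fun c =>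
    (hP (t⁻¹ * c)).comp (f := fun z => z⁻¹ * c) (by fun_prop (disch := exact ht))
  have z1 := qPoch_ne_zero hQ n1
  have z2 := qPoch_ne_zero hQ n2
  have z3 := qPoch_ne_zero hQ n3
  have z4 := qPoch_ne_zero hQ n4
  have an := a0.mul ((a1 (q ^ 2)).mul (a2 1))
  have ad := (a1 q).mul (a2 q)
  have heq : thetaRatio a L =ᶠ[𝓝 t] (fun z => Complex.exp (a / 4 + L z / 2)) *
      ((fun z => qPoch (z * q ^ 2) (q ^ 2)) * fun z => qPoch (z⁻¹ * 1) (q ^ 2)) /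
      ((fun z => qPoch (z * q) (q ^ 2)) * fun z => qPoch (z⁻¹ * q) (q ^ 2)) := by
    filter_upwards [hL.2, isOpen_ne.mem_nhds ht] with z h1 h2
    exact thetaRatio_eq hq ha h2 h1
  have hbranch : logDeriv (fun z => Complex.exp (a / 4 + L z / 2)) t = deriv L t / 2 := by
    have hd := (((hL.1.differentiableAt.hasDerivAt).div_const 2).const_add (a / 4)).cexp
    rw [logDeriv_apply, hd.deriv, mul_div_cancel_left₀ _ (Complex.exp_ne_zero _)]
  have hderivL : t * deriv L t = 1 := by
    have hd : HasDerivAt (fun z : ℂ => -z) (-1) t := (hasDerivAt_id t).neg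
    rw [hL.deriv_eq_logDeriv, logDeriv_apply, hd.deriv]
    field_simp
  constructor
  · obtain ⟨ℓ, hℓ⟩ := exists_isLogBranchAt (an.div ad (mul_ne_zero z2 z3))
      (div_ne_zero (mul_ne_zero (Complex.exp_ne_zero _) (mul_ne_zero z1 z4)) (mul_ne_zero z2 z3))
    exact ⟨ℓ, hℓ.congr heq.symm⟩
  · have key := logDeriv_mul_mul_div_mul (f := fun z => Complex.exp (a / 4 + L z / 2))
      (g := fun z => qPoch (z * q ^ 2) (q ^ 2)) (h := fun z => qPoch (z⁻¹ * 1) (q ^ 2))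
      (k := fun z => qPoch (z * q) (q ^ 2)) (l := fun z => qPoch (z⁻¹ * q) (q ^ 2))
      (Complex.exp_ne_zero _) z1 z4 z2 z3 a0.differentiableAt (a1 _).differentiableAt
      (a2 _).differentiableAt (a1 _).differentiableAt (a2 _).differentiableAt
    rw [logDeriv_apply, ← heq.deriv_eq, ← heq.eq_of_nhds, ← logDeriv_apply] at key
    rw [key, hbranch,
      ← mul_logDeriv_qPoch_mul hQ _ n1, ← mul_logDeriv_qPoch_mul hQ _ n2,
      ← mul_logDeriv_qPoch_inv_mul hQ ht _ n3, ← mul_logDeriv_qPoch_inv_mul hQ ht _ n4]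
    linear_combination hderivL / 2

end Branches

/-! ### Assembling the two formulas -/

theorem lambert_two_sums {q t : ℂ} (hq : ‖q‖ < 1) (hqt : ‖q * t⁻¹‖ < 1) (htq : ‖q * t‖ < 1) :
    (Summable fun n : ℕ => q ^ (n + 1) * coeff t (n + 1) / (1 + q ^ (n + 1))) ∧
    (Summable fun r : ℕ => (-1) ^ r * q ^ (r + 1) * t / (1 - q ^ (r + 1) * t)
        - (-1) ^ r * q ^ (r + 1) * t⁻¹ / (1 - q ^ (r + 1) * t⁻¹)) ∧
    ∑' n : ℕ, q ^ (n + 1) * coeff t (n + 1) / (1 + q ^ (n + 1)) =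
      ∑' r : ℕ, ((-1) ^ r * q ^ (r + 1) * t / (1 - q ^ (r + 1) * t)
        - (-1) ^ r * q ^ (r + 1) * t⁻¹ / (1 - q ^ (r + 1) * t⁻¹)) := by
  obtain ⟨s1, s2, h1⟩ := lambert_swap hq htq
  obtain ⟨s3, s4, h2⟩ := lambert_swap hq hqt
  have e : ∀ n : ℕ, q ^ (n + 1) * coeff t (n + 1) / (1 + q ^ (n + 1)) =
      (q * t) ^ (n + 1) / (1 + q ^ (n + 1)) - (q * t⁻¹) ^ (n + 1) / (1 + q ^ (n + 1)) := fun n => by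
    rw [coeff, mul_pow, mul_pow, inv_pow]; ring
  simp only [e]
  exact ⟨s1.sub s3, s2.sub s4, by rw [s1.tsum_sub s3, s2.tsum_sub s4, h1, h2]⟩

end RamondFock

theorem mainTheorem1 (q t : ℂ) (hq : ‖q‖ < 1) (hqt : ‖q‖ < ‖t‖) (htq : ‖q‖ * ‖t‖ < 1) :
    -- the normally ordered one-point function
    (Summable (RamondFock.diagF0 (RamondFock.qL0 q * RamondFock.normalB0 t)) ∧
      (Summable fun n : ℕ => q ^ (n + 1) * (t ^ (n + 1) - (t ^ (n + 1))⁻¹) / (1 + q ^ (n + 1))) ∧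
      RamondFock.normalR q t = RamondFock.qPoch (-q) q *
        ∑' n : ℕ, q ^ (n + 1) * (t ^ (n + 1) - (t ^ (n + 1))⁻¹) / (1 + q ^ (n + 1)) ∧
      (Summable fun r : ℕ => (-1) ^ r * q ^ (r + 1) * t / (1 - q ^ (r + 1) * t)
        - (-1) ^ r * q ^ (r + 1) * t⁻¹ / (1 - q ^ (r + 1) * t⁻¹)) ∧
      RamondFock.normalR q t = RamondFock.qPoch (-q) q *
        ∑' r : ℕ, ((-1) ^ r * q ^ (r + 1) * t / (1 - q ^ (r + 1) * t)
          - (-1) ^ r * q ^ (r + 1) * t⁻¹ / (1 - q ^ (r + 1) * t⁻¹))) ∧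
    -- the one-point function, away from its pole at `t = 1`
    (t ≠ 1 →
      Summable (RamondFock.diagF0 (RamondFock.qL0 q * RamondFock.B0 t)) ∧
      -- for all branches of `q ^ (n ^ 2)` and `(-t) ^ n` with `n` a half-integer
      ∀ a : ℂ, Complex.exp a = q →
      ∀ L : ℂ → ℂ, RamondFock.IsLogBranchAt (fun z => -z) L t →
        (∃ ℓ : ℂ → ℂ, RamondFock.IsLogBranchAt (RamondFock.thetaRatio a L) ℓ t) ∧
        ∀ ℓ : ℂ → ℂ, RamondFock.IsLogBranchAt (RamondFock.thetaRatio a L) ℓ t →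
          RamondFock.R q t = RamondFock.qPoch (-q) q * (t * deriv ℓ t)) := by
  have ht : t ≠ 0 := norm_pos_iff.1 ((norm_nonneg q).trans_lt hqt)
  have hqt' : ‖q * t⁻¹‖ < 1 := by
    rw [norm_mul, norm_inv, ← div_eq_mul_inv, div_lt_one (norm_pos_iff.2 ht)]; exact hqt
  have htq' : ‖q * t‖ < 1 := by rwa [norm_mul]
  obtain ⟨s1, s2, hs⟩ := RamondFock.lambert_two_sums hq hqt' htq'
  have hN := RamondFock.hasSum_diagF0_normalB0 hq hqt' htq'
  have hB := RamondFock.hasSum_diagF0_B0 hq hqt' htq'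
  refine ⟨⟨hN.summable, s1, hN.tsum_eq, s2, hs ▸ hN.tsum_eq⟩, fun ht1 => ⟨hB.summable, ?_⟩⟩
  intro a ha L hL
  obtain ⟨hex, hd⟩ := RamondFock.exists_branch_and_deriv_thetaRatio hq hqt' htq' ht ht1 ha hL
  refine ⟨hex, fun ℓ hℓ => hB.tsum_eq.trans ?_⟩
  have hQ : ‖q ^ 2‖ < 1 := by rw [norm_pow]; exact pow_lt_one₀ (norm_nonneg q) hq two_ne_zero
  rw [hℓ.deriv_eq_logDeriv, hd, hs, (RamondFock.lambert_swap hq htq').2.1.tsum_sub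
    (RamondFock.lambert_swap hq hqt').2.1, RamondFock.tsum_alternating_eq_lambert hq,
    RamondFock.tsum_alternating_eq_lambert hq, RamondFock.lambert_eq_add hQ (t⁻¹ * 1), mul_one]
  congr 1
  have h1 : t - 1 ≠ 0 := sub_ne_zero.2 ht1
  have h2 : 1 - t⁻¹ ≠ 0 := sub_ne_zero.2 fun h => ht1 (inv_eq_one.1 h.symm)
  -- The normal ordering constant is the exponent 1/2 of (-t)^{1/2} plus the split-off term of the
  -- Lambert series at t^{-1}.
  have h3 : (t + 1) / (2 * (t - 1)) = 1 / 2 + t⁻¹ / (1 - t⁻¹) := by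
    have : t⁻¹ / (1 - t⁻¹) = 1 / (t - 1) := by
      rw [div_eq_div_iff h2 h1, mul_sub, inv_mul_cancel₀ ht]; ring
    rw [this]
    field_simp
    ring
  rw [h3]
  ring
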